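/- Let $X=\{0,1\}$ and let $\operatorname{Aut}(X^*)$ be the automorphism group of the binary rooted tree $X^*$ of finite words over $X$. Groups act on the right, $a^b=b^{-1}ab$ and $[a,b]=a^{-1}b^{-1}ab$. For $g_0,g_1\in\operatorname{Aut}(X^*)$ let $\langle g_0,g_1\rangle\in\operatorname{Aut}(X^*)$ be given by $(0w)^{\langle g_0,g_1\rangle}=0\,w^{g_0}$ and $(1w)^{\langle g_0,g_1\rangle}=1\,w^{g_1}$, and let $\sigma$ be given by $(0w)^\sigma=1w$ and $(1w)^\sigma=0w$. Let $n\ge 1$, let $v=x_1x_2\cdots x_{n-1}$ be a (possibly empty) word over $X$, and let $\mathfrak K(v)$ be the subgroup of $\operatorname{Aut}(X^*)$ generated by the elements $a_1,\dots,a_n$ defined recursively by \[a_1=\langle 1,a_n\rangle\sigma,\qquad a_{i+1}=\begin{cases}\langle a_i,1\rangle&\text{if }x_i=0,\\ \langle 1,a_i\rangle&\text{if }x_i=1,\end{cases}\qquad 1\le i<n.\] Let $F_n$ be the free group on the symbols $a_1,\dots,a_n$, let $\varphi$ be the endomorphism of $F_n$ with \[\varphi(a_n)=a_1^2,\qquad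 \varphi(a_i)=\begin{cases}a_{i+1}&\text{if }x_i=0,\\ a_1a_{i+1}a_1^{-1}&\text{if }x_i=1,\end{cases}\qquad 1\le i<n,\] and let $\mathcal R_2\subset F_n$ be the set of the commutators $\big[a_i,a_j^{a_1^k}\big]$ with $2\le i,j\le n$ and $0\le k\le 2$, where $x_{i-1}\ne x_{j-1}$ if $k\in\{0,2\}$, and $x_{i-1}=x_{j-1}$ if $k=1$. Theorem. The set $\mathcal R_2$ is finite, and the group $\mathfrak K(v)$ has the recursive presentation \[\mathfrak K(v)=\big\langle a_1,\dots,a_n\ \big|\ \varphi^\ell(\mathcal R_2)\text{ for all }\ell\ge 0\big\rangle,\] in which the generator $a_i$ of the presentation corresponds to the element $a_i$ of $\mathfrak K(v)$. -/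

import Mathlib

namespace Kneading

/-- Vertices of the binary rooted tree `X^*` are words over `X = {0, 1}`, with `0 = false` and
`1 = true`. The children of `u` are the words `ux` with `x` a letter. -/
def IsChild (u v : List Bool) : Prop := ∃ b : Bool, v = u ++ [b]

/-- `Aut(X^*)`, the group of automorphisms of the binary rooted tree. Groups act on the right, so
the group law is the opposite of composition of functions: in `g * h`, first `g` acts, then `h`. -/
def treeAut : Subgroup (Equiv.Perm (List Bool))ᵐᵒᵖ where
  carrier := {g | g.unop [] = [] ∧ ∀ u v, IsChild u v ↔ IsChild (g.unop u) (g.unop v)}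
  one_mem' := ⟨rfl, fun _ _ => Iff.rfl⟩
  mul_mem' := by
    rintro g h ⟨g0, hg⟩ ⟨h0, hh⟩
    refine ⟨?_, fun u v => ?_⟩
    · simp [g0, h0]
    · simpa using (hg u v).trans (hh _ _)
  inv_mem' := by
    rintro g ⟨g0, hg⟩
    refine ⟨?_, fun u v => ?_⟩
    · show g.unop.symm [] = []
      rw [Equiv.symm_apply_eq, g0]
    · show _ ↔ IsChild (g.unop.symm u) (g.unop.symm v)
      rw [hg (g.unop.symm u), Equiv.apply_symm_apply, Equiv.apply_symm_apply]

/-- The right action `w ^ g` of a tree automorphism on a word. -/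
def act (w : List Bool) (g : treeAut) : List Bool := g.1.unop w

theorem act_mul (w : List Bool) (g h : treeAut) : act w (g * h) = act (act w g) h := rfl

theorem act_ext {g h : treeAut} (H : ∀ w, act w g = act w h) : g = h :=
  Subtype.ext (MulOpposite.unop_injective (Equiv.ext H))

theorem isChild_cons {b : Bool} {u v : List Bool} : IsChild (b :: u) (b :: v) ↔ IsChild u v := by
  simp [IsChild]

/-- A pair of mutually inverse maps that send children to children is a tree automorphism. -/
def mkAut (f f' : List Bool → List Bool) (h : ∀ w, f' (f w) = w) (h' : ∀ w, f (f' w) = w)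
    (f0 : f [] = []) (hf : ∀ u b, IsChild (f u) (f (u ++ [b])))
    (hf' : ∀ u b, IsChild (f' u) (f' (u ++ [b]))) : treeAut :=
  ⟨MulOpposite.op ⟨f, f', h, h'⟩, f0, fun u v => by
    constructor
    · rintro ⟨b, rfl⟩
      exact hf u b
    · rintro ⟨b, hb⟩
      change f v = f u ++ [b] at hb
      have := hf' (f u) b
      rwa [← hb, h, h] at this⟩

/-- The map underlying `⟨g₀, g₁⟩`. -/
def pairFun (g₀ g₁ : treeAut) : List Bool → List Bool
  | [] => []
  | false :: w => false :: act w g₀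
  | true :: w => true :: act w g₁

theorem pairFun_child (g₀ g₁ : treeAut) (u : List Bool) (b : Bool) :
    IsChild (pairFun g₀ g₁ u) (pairFun g₀ g₁ (u ++ [b])) := by
  have key (g : treeAut) (w : List Bool) : IsChild (act w g) (act (w ++ [b]) g) :=
    (g.2.2 _ _).1 ⟨b, rfl⟩
  have root (g : treeAut) : act [] g = [] := g.2.1
  match u with
  | [] => cases b <;> simp [pairFun, IsChild, root]
  | false :: w => exact isChild_cons.2 (key g₀ w)
  | true :: w => exact isChild_cons.2 (key g₁ w)

theorem pairFun_inv (g₀ g₁ : treeAut) (w : List Bool) :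
    pairFun g₀⁻¹ g₁⁻¹ (pairFun g₀ g₁ w) = w := by
  have key (g : treeAut) (w : List Bool) : act (act w g) g⁻¹ = w := by
    rw [← act_mul, mul_inv_cancel]
    rfl
  match w with
  | [] => rfl
  | false :: w => exact congrArg _ (key g₀ w)
  | true :: w => exact congrArg _ (key g₁ w)

/-- The automorphism `⟨g₀, g₁⟩`: `(0w)^⟨g₀, g₁⟩ = 0 w^g₀` and `(1w)^⟨g₀, g₁⟩ = 1 w^g₁`. -/
def pair (g₀ g₁ : treeAut) : treeAut :=
  mkAut (pairFun g₀ g₁) (pairFun g₀⁻¹ g₁⁻¹) (pairFun_inv g₀ g₁)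
    (fun w => by simpa using pairFun_inv g₀⁻¹ g₁⁻¹ w) rfl
    (pairFun_child g₀ g₁) (pairFun_child g₀⁻¹ g₁⁻¹)

/-- The map underlying `σ`. -/
def sigmaFun : List Bool → List Bool
  | [] => []
  | b :: w => (!b) :: w

theorem sigmaFun_sigmaFun (w : List Bool) : sigmaFun (sigmaFun w) = w := by
  cases w <;> simp [sigmaFun]

theorem sigmaFun_child (u : List Bool) (b : Bool) :
    IsChild (sigmaFun u) (sigmaFun (u ++ [b])) := by
  cases u <;> simp [sigmaFun, IsChild]

/-- The automorphism `σ`: `(0w)^σ = 1w` and `(1w)^σ = 0w`. -/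
def sigma : treeAut :=
  mkAut sigmaFun sigmaFun sigmaFun_sigmaFun sigmaFun_sigmaFun rfl sigmaFun_child sigmaFun_child

/-! Let `v = x₁ … x_{n-1}` with `n = m + 1`, given as `x : Fin m → Bool`. Indices are shifted by
one: `x j` is `x_{j+1}` for `j < m`, and index `i : Fin (m + 1)` stands for `a_{i+1}`. -/

variable {m : ℕ}

/-- The maps underlying the generators, defined by recursion on words:
`a₁ = ⟨1, a_n⟩σ`, while `a_{i+1}` acts by `a_i` below the letter `x_i` and trivially below the
other letter. The recursions are `gen_zero` and `gen_succ`. -/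
def genFun (x : Fin m → Bool) : List Bool → Fin (m + 1) → List Bool
  | [], _ => []
  | b :: w, i =>
    Fin.cases
      (if b = false then true :: w else false :: genFun x w (Fin.last m))
      (fun j => if b = x j then b :: genFun x w j.castSucc else b :: w) i

/-- The inverse of `genFun`. -/
def genInv (x : Fin m → Bool) : List Bool → Fin (m + 1) → List Bool
  | [], _ => []
  | b :: w, i =>
    Fin.cases
      (if b = true then false :: w else true :: genInv x w (Fin.last m))
      (fun j => if b = x j then b :: genInv x w j.castSucc else b :: w) i

theorem genInv_genFun (x : Fin m → Bool) (w : List Bool) (i : Fin (m + 1)) :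
    genInv x (genFun x w i) i = w := by
  induction w generalizing i with
  | nil => rfl
  | cons b w ih =>
    induction i using Fin.cases with
    | zero => cases b <;> simp [genFun, genInv, ih]
    | succ j => by_cases h : b = x j <;> simp [genFun, genInv, h, ih]

theorem genFun_genInv (x : Fin m → Bool) (w : List Bool) (i : Fin (m + 1)) :
    genFun x (genInv x w i) i = w := by
  induction w generalizing i with
  | nil => rfl
  | cons b w ih =>
    induction i using Fin.cases with
    | zero => cases b <;> simp [genFun, genInv, ih]
    | succ j => by_cases h : b = x j <;> simp [genFun, genInv, h, ih]

theorem genFun_child (x : Fin m → Bool) (i : Fin (m + 1)) (u : List Bool) (c : Bool) :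
    IsChild (genFun x u i) (genFun x (u ++ [c]) i) := by
  induction u generalizing i with
  | nil =>
    induction i using Fin.cases with
    | zero => cases c <;> simp [genFun, IsChild]
    | succ j => by_cases h : c = x j <;> simp [genFun, IsChild, h]
  | cons b w ih =>
    induction i using Fin.cases with
    | zero =>
      cases b
      · simp [genFun, IsChild]
      · simpa [genFun] using isChild_cons.2 (ih _)
    | succ j =>
      by_cases h : b = x j
      · simpa [genFun, h] using isChild_cons.2 (ih _)
      · simp [genFun, IsChild, h]

theorem genInv_child (x : Fin m → Bool) (i : Fin (m + 1)) (u : List Bool) (c : Bool) :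
    IsChild (genInv x u i) (genInv x (u ++ [c]) i) := by
  induction u generalizing i with
  | nil =>
    induction i using Fin.cases with
    | zero => cases c <;> simp [genInv, IsChild]
    | succ j => by_cases h : c = x j <;> simp [genInv, IsChild, h]
  | cons b w ih =>
    induction i using Fin.cases with
    | zero =>
      cases b
      · simpa [genInv] using isChild_cons.2 (ih _)
      · simp [genInv, IsChild]
    | succ j =>
      by_cases h : b = x j
      · simpa [genInv, h] using isChild_cons.2 (ih _)
      · simp [genInv, IsChild, h]

/-- The generators: `gen x i` is `a_{i+1}`, for `0 ≤ i < n`. -/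
def gen (x : Fin m → Bool) (i : Fin (m + 1)) : treeAut :=
  mkAut (fun w => genFun x w i) (fun w => genInv x w i) (genInv_genFun x · i)
    (genFun_genInv x · i) rfl (genFun_child x i) (genInv_child x i)

/-- `a₁ = ⟨1, a_n⟩σ`. -/
theorem gen_zero (x : Fin m → Bool) : gen x 0 = pair 1 (gen x (Fin.last m)) * sigma := by
  refine act_ext fun w => ?_
  match w with
  | [] => rfl
  | false :: w => rfl
  | true :: w => rfl

/-- `a_{i+1} = ⟨a_i, 1⟩` if `x_i = 0`, and `a_{i+1} = ⟨1, a_i⟩` if `x_i = 1`. -/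
theorem gen_succ (x : Fin m → Bool) (j : Fin m) :
    gen x j.succ = if x j = false then pair (gen x j.castSucc) 1
      else pair 1 (gen x j.castSucc) := by
  refine act_ext fun w => ?_
  match w with
  | [] => split_ifs <;> rfl
  | b :: w =>
    show genFun x (b :: w) j.succ = _
    cases h : x j <;> cases b <;> simp [genFun, h] <;> rfl

/-- The group `𝔎(v)`: the subgroup of `Aut(X^*)` generated by `a₁, …, a_n`. -/
def kneadingGroup (x : Fin m → Bool) : Subgroup treeAut :=
  Subgroup.closure (Set.range (gen x))

/-- `a ^ b = b⁻¹ a b`. -/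
def conj {G : Type*} [Group G] (a b : G) : G := b⁻¹ * a * b

/-- `[a, b] = a⁻¹ b⁻¹ a b`. -/
def comm {G : Type*} [Group G] (a b : G) : G := a⁻¹ * b⁻¹ * a * b

/-- The endomorphism `φ` of the free group on `a₁, …, a_n`: `φ(a_n) = a₁²`, and for `i < n`,
`φ(a_i) = a_{i+1}` if `x_i = 0` and `φ(a_i) = a₁ a_{i+1} a₁⁻¹` if `x_i = 1`. -/
def phi (x : Fin m → Bool) : FreeGroup (Fin (m + 1)) →* FreeGroup (Fin (m + 1)) :=
  FreeGroup.lift (Fin.lastCases (FreeGroup.of 0 ^ 2)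
    (fun j : Fin m =>
      if x j = false then FreeGroup.of j.succ
      else FreeGroup.of 0 * FreeGroup.of j.succ * (FreeGroup.of 0)⁻¹))

/-- The set `R_r` of the commutators `[a_i, a_j ^ (a₁ ^ k)]`, `2 ≤ i, j ≤ n`, `0 ≤ k ≤ r`, with
`x_{i-1} ≠ x_{j-1}` when `k` is even and `x_{i-1} = x_{j-1}` when `k` is odd
(here `i = p + 2` and `j = q + 2`). -/
def rels (x : Fin m → Bool) (r : ℕ) : Set (FreeGroup (Fin (m + 1))) :=
  {g | ∃ (p q : Fin m) (k : ℕ), k ≤ r ∧ (Even k ∧ x p ≠ x q ∨ Odd k ∧ x p = x q) ∧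
    g = comm (FreeGroup.of p.succ) (conj (FreeGroup.of q.succ) (FreeGroup.of 0 ^ k))}

end Kneading

/-! Let N be the normal closure of the relators and ψ the wreath recursion on the free group
(`recursion`). The endomorphism φ almost splits ψ: ψ(φ(g)) = ⟨g, a_n^e(g)⟩, with e(g) the exponent
sum of a_n (`recursion_phi`). Elements of R₂ have trivial recursion and e vanishes on all relators,
so ψ(N) lies in N × N and N acts trivially on the tree.

Conversely, ψ induces an injective recursion modulo N (`mem_relatorSubgroup_of_recursion_mem`). The
relators force φ(a_i), i < n, to commute with every a₁²-conjugate of φ(a_j)^a₁, j < n. Hence modulo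
N each element fixing the first level is φ(u) φ(w)^a₁ with e(w) = 0. Its recursion is ⟨u, a_n^e(u)
w⟩; if this lies in N × N, then u ∈ N, so e(u) = 0 and w ∈ N.

Finally, a shortest word acting trivially but lying outside N has a section of the same length,
namely the word with its indices shifted cyclically, and that section is again such a word. Every
nonempty reduced word has a pattern that excludes this after finitely many shifts (`exists_pattern`,
`ker_treeHom_le`). -/

namespace Kneading

/-! ### Wreath product with the symmetric group of two letters. -/

/-- The permutational wreath product of `G` with the symmetric group of `{0, 1}`: the pairs
`⟨g₀, g₁⟩ σ ^ e`. -/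
structure Wreath (G : Type*) where
  /-- The pair `⟨g₀, g₁⟩`. -/
  sec : Bool → G
  /-- The exponent of `σ`. -/
  flip : Bool

namespace Wreath

@[ext]
theorem ext {G : Type*} {a b : Wreath G} (h₀ : a.sec false = b.sec false)
    (h₁ : a.sec true = b.sec true) (h : a.flip = b.flip) : a = b := by
  obtain ⟨f, e⟩ := a
  obtain ⟨f', e'⟩ := b
  obtain rfl : f = f' := funext fun s => by cases s <;> assumption
  obtain rfl : e = e' := h
  rfl

variable {G : Type*} [Group G]

instance : Mul (Wreath G) := ⟨fun a b => ⟨fun s => a.sec s * b.sec (s ^^ a.flip), a.flip ^^ b.flip⟩⟩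

instance : One (Wreath G) := ⟨⟨1, false⟩⟩

instance : Inv (Wreath G) := ⟨fun a => ⟨fun s => (a.sec (s ^^ a.flip))⁻¹, a.flip⟩⟩

@[simp] theorem mul_sec (a b : Wreath G) (s : Bool) :
    (a * b).sec s = a.sec s * b.sec (s ^^ a.flip) := rfl

@[simp] theorem mul_flip (a b : Wreath G) : (a * b).flip = (a.flip ^^ b.flip) := rfl

@[simp] theorem one_sec (s : Bool) : (1 : Wreath G).sec s = 1 := rfl

@[simp] theorem one_flip : (1 : Wreath G).flip = false := rfl

@[simp] theorem inv_sec (a : Wreath G) (s : Bool) : a⁻¹.sec s = (a.sec (s ^^ a.flip))⁻¹ := rfl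

@[simp] theorem inv_flip (a : Wreath G) : a⁻¹.flip = a.flip := rfl

instance : Group (Wreath G) :=
  Group.ofLeftAxioms
    (fun a b c => by ext <;> simp [mul_assoc])
    (fun a => by ext <;> simp)
    (fun a => by ext <;> simp)

/-- The pairs `⟨g₀, g₁⟩` with `g₀, g₁ ∈ N`. -/
def base (N : Subgroup G) : Subgroup (Wreath G) where
  carrier := {a | a.flip = false ∧ ∀ s, a.sec s ∈ N}
  one_mem' := ⟨rfl, fun _ => N.one_mem⟩
  mul_mem' := fun ⟨ha, ha'⟩ ⟨hb, hb'⟩ =>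
    ⟨by simp [ha, hb], fun s => N.mul_mem (ha' s) (hb' _)⟩
  inv_mem' := fun ⟨ha, ha'⟩ => ⟨ha, fun _ => N.inv_mem (ha' _)⟩

instance (N : Subgroup G) [hN : N.Normal] : (base N).Normal where
  conj_mem := fun a ⟨ha, ha'⟩ g => by
    refine ⟨by simp [ha], fun s => ?_⟩
    simpa [ha] using hN.conj_mem _ (ha' (s ^^ g.flip)) (g.sec s)

end Wreath

/-! ### Commutation of conjugates in an arbitrary group. -/

section Conj

variable {G : Type*} [Group G]

theorem comm_eq_one_iff {a b : G} : comm a b = 1 ↔ Commute a b := by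
  rw [comm, mul_assoc, ← mul_inv_rev, inv_mul_eq_one, eq_comm]
  rfl

theorem map_comm {G' : Type*} [Group G'] (f : G →* G') (a b : G) :
    f (comm a b) = comm (f a) (f b) := by
  simp [comm]

theorem map_conj {G' : Type*} [Group G'] (f : G →* G') (a b : G) :
    f (conj a b) = conj (f a) (f b) := by
  simp [conj]

/-- If `b` commutes with `d⁻¹bd`, then the conjugates of `d` by the powers of `b` lie in the
subgroup generated by `d` and `bdb⁻¹`. -/
theorem commute_conj_zpow {b c d : G} (hb : Commute b (d⁻¹ * b * d)) (h₀ : Commute c d)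
    (h₁ : Commute c (b * d * b⁻¹)) (k : ℤ) : Commute c (b ^ k * d * (b ^ k)⁻¹) := by
  have h : b ^ k * d * (b ^ k)⁻¹ = d * (d⁻¹ * b * d * b⁻¹) ^ k := by
    have h' : (d⁻¹ * b * d) ^ k = d⁻¹ * b ^ k * d := by
      simpa using conj_zpow (a := d⁻¹) (b := b) (i := k)
    rw [hb.symm.inv_right.mul_zpow, h', inv_zpow]
    group
  rw [h]
  refine h₀.mul_right (Commute.zpow_right ?_ k)
  have : d⁻¹ * b * d * b⁻¹ = d⁻¹ * (b * d * b⁻¹) := by group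
  rw [this]
  exact h₀.inv_right.mul_right h₁

/-- Write `d` as the conjugate of `e⁻¹ * d * e` by `e⁻¹`. Powers of `b` fix the inner element, so
conjugation by `b ^ k` only changes `e`, and all the resulting factors commute with `c`. -/
theorem commute_conj_zpow_of_commute_conj {b c d e : G} {k : ℤ}
    (hc : Commute c (b ^ k * e * (b ^ k)⁻¹)) (he : Commute c e) (hd : Commute c d)
    (hb : Commute b (e⁻¹ * d * e)) : Commute c (b ^ k * d * (b ^ k)⁻¹) := by
  have h : b ^ k * d * (b ^ k)⁻¹ =
      (b ^ k * e * (b ^ k)⁻¹) * (e⁻¹ * d * e) * (b ^ k * e * (b ^ k)⁻¹)⁻¹ := by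
    have h' : e⁻¹ * d * e = (b ^ k)⁻¹ * (e⁻¹ * d * e) * b ^ k := by
      rw [mul_assoc (b ^ k)⁻¹, ← (hb.zpow_left k).eq, inv_mul_cancel_left]
    calc b ^ k * d * (b ^ k)⁻¹
        = b ^ k * e * (e⁻¹ * d * e) * e⁻¹ * (b ^ k)⁻¹ := by group
      _ = b ^ k * e * ((b ^ k)⁻¹ * (e⁻¹ * d * e) * b ^ k) * e⁻¹ * (b ^ k)⁻¹ := by rw [← h']
      _ = _ := by simp [mul_assoc]
  rw [h]
  exact (hc.mul_right ((he.inv_right.mul_right hd).mul_right he)).mul_right hc.inv_right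

end Conj

open FreeGroup (of)

variable {m : ℕ} (x : Fin m → Bool)

/-! ### Relators and the wreath recursion on the free group. -/

/-- The defining relators of the presentation. -/
def relators : Set (FreeGroup (Fin (m + 1))) := ⋃ l : ℕ, (phi x)^[l] '' rels x 2

/-- The normal closure of the defining relators. -/
def relatorSubgroup : Subgroup (FreeGroup (Fin (m + 1))) := Subgroup.normalClosure (relators x)

instance : (relatorSubgroup x).Normal := Subgroup.normalClosure_normal

/-- The wreath recursion on the free group. -/
def recursion : FreeGroup (Fin (m + 1)) →* Wreath (FreeGroup (Fin (m + 1))) :=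
  FreeGroup.lift (Fin.cases ⟨fun s => if s then of (Fin.last m) else 1, true⟩
    fun j => ⟨fun s => if s = x j then of j.castSucc else 1, false⟩)

@[simp] theorem recursion_zero :
    recursion x (of 0) = ⟨fun s => if s then of (Fin.last m) else 1, true⟩ := by
  simp [recursion]

@[simp] theorem recursion_succ (j : Fin m) :
    recursion x (of j.succ) = ⟨fun s => if s = x j then of j.castSucc else 1, false⟩ := by
  simp [recursion]

@[simp] theorem phi_last : phi x (of (Fin.last m)) = of 0 ^ 2 := by simp [phi]

@[simp] theorem phi_castSucc (j : Fin m) : phi x (of j.castSucc) =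
    if x j = false then of j.succ else of 0 * of j.succ * (of 0)⁻¹ := by simp [phi]

/-- The exponent sum of `a_n`. -/
def lastExponent (m : ℕ) : FreeGroup (Fin (m + 1)) →* Multiplicative ℤ :=
  FreeGroup.lift (Fin.lastCases (Multiplicative.ofAdd 1) fun _ => 1)

@[simp] theorem lastExponent_last : lastExponent m (of (Fin.last m)) = Multiplicative.ofAdd 1 := by
  simp [lastExponent]

@[simp] theorem lastExponent_castSucc (j : Fin m) : lastExponent m (of j.castSucc) = 1 := by
  simp [lastExponent]

/-- The wreath recursion maps `φ(g)` to `⟨g, a_n ^ e⟩` with `e` the exponent sum of `a_n`. -/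
theorem recursion_phi (g : FreeGroup (Fin (m + 1))) : recursion x (phi x g) =
    ⟨fun s => if s then of (Fin.last m) ^ (lastExponent m g).toAdd else g, false⟩ := by
  let f : FreeGroup (Fin (m + 1)) →* Wreath (FreeGroup (Fin (m + 1))) :=
    { toFun := fun g =>
        ⟨fun s => if s then of (Fin.last m) ^ (lastExponent m g).toAdd else g, false⟩
      map_one' := by ext <;> simp
      map_mul' := fun g h => by ext <;> simp [zpow_add] }
  suffices h : (recursion x).comp (phi x) = f from DFunLike.congr_fun h g
  refine FreeGroup.ext_hom _ _ fun i => ?_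
  induction i using Fin.lastCases with
  | last => ext <;> simp [f, pow_two]
  | cast j => cases h : x j <;> ext <;> simp [f, h]

theorem relatorSubgroup_le_comap_phi :
    relatorSubgroup x ≤ (relatorSubgroup x).comap (phi x) := by
  refine Subgroup.normalClosure_le_normal ?_
  intro r hr
  obtain ⟨l, r', hr', rfl⟩ := Set.mem_iUnion.1 hr
  refine Subgroup.subset_normalClosure (Set.mem_iUnion.2 ⟨l + 1, r', hr', ?_⟩)
  rw [Function.iterate_succ_apply']

theorem phi_iterate_comm (l : ℕ) (a b : FreeGroup (Fin (m + 1))) :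
    (phi x)^[l] (comm a b) = comm ((phi x)^[l] a) ((phi x)^[l] b) := by
  induction l generalizing a b with
  | zero => rfl
  | succ l ih => simp [map_comm, ih]

theorem relatorSubgroup_le_ker_lastExponent :
    relatorSubgroup x ≤ (lastExponent m).ker := by
  refine Subgroup.normalClosure_le_normal ?_
  intro r hr
  obtain ⟨l, _, ⟨p, q, k, -, -, rfl⟩, rfl⟩ := Set.mem_iUnion.1 hr
  rw [phi_iterate_comm, SetLike.mem_coe, MonoidHom.mem_ker, map_comm, comm_eq_one_iff]
  exact Commute.all _ _

/-- The generator a_i is supported below x_{i-1}, and conjugation by a₁^k moves the support of a_j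
to the letter x_{j-1} + k mod 2. The condition on `k` makes the two supports disjoint. -/
theorem recursion_rels {r : FreeGroup (Fin (m + 1))} (hr : r ∈ rels x 2) :
    recursion x r = 1 := by
  obtain ⟨p, q, k, hk, h, rfl⟩ := hr
  rw [map_comm, map_conj, map_pow]
  interval_cases k <;> cases hp : x p <;> cases hq : x q <;> simp [hp, hq, show ¬ Odd 2 by decide] at h <;>
    ext <;> simp [comm, conj, hp, hq, pow_two, mul_assoc]

theorem relatorSubgroup_le_comap_recursion :
    relatorSubgroup x ≤ (Wreath.base (relatorSubgroup x)).comap (recursion x) := by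
  refine Subgroup.normalClosure_le_normal ?_
  intro r hr
  obtain ⟨l, r', hr', rfl⟩ := Set.mem_iUnion.1 hr
  cases l with
  | zero =>
    change recursion x r' ∈ Wreath.base _
    rw [recursion_rels x hr']
    exact one_mem _
  | succ l =>
    have h : (phi x)^[l] r' ∈ relatorSubgroup x :=
      Subgroup.subset_normalClosure (Set.mem_iUnion.2 ⟨l, r', hr', rfl⟩)
    rw [Function.iterate_succ_apply', SetLike.mem_coe, Subgroup.mem_comap, recursion_phi]
    refine ⟨rfl, fun s => ?_⟩
    have h' : lastExponent m ((phi x)^[l] r') = 1 := relatorSubgroup_le_ker_lastExponent x h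
    cases s <;> simp [h, h']

/-! ### The action on the tree kills the relators. -/

/-- The action of the free group on the tree. -/
def treeHom : FreeGroup (Fin (m + 1)) →* treeAut := FreeGroup.lift (gen x)

@[simp] theorem treeHom_of (i : Fin (m + 1)) : treeHom x (of i) = gen x i := by simp [treeHom]

theorem act_nil (g : treeAut) : act [] g = [] := g.2.1

theorem act_one (w : List Bool) : act w 1 = w := rfl

theorem act_cons_treeHom (g : FreeGroup (Fin (m + 1))) (s : Bool) (w : List Bool) :
    act (s :: w) (treeHom x g) =
      (s ^^ (recursion x g).flip) :: act w (treeHom x ((recursion x g).sec s)) := by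
  induction g using FreeGroup.induction_on generalizing s w with
  | C1 => simp [act_one]
  | of i =>
    change genFun x (s :: w) i = _
    induction i using Fin.cases with
    | zero =>
      cases s
      · simp [genFun, act_one]
      · simp [genFun]
        rfl
    | succ j =>
      by_cases h : s = x j
      · simp [genFun, h]
        rfl
      · simp [genFun, h, act_one]
  | inv_of i ih =>
    -- The inverse case is checked after acting by the generator itself, where the generator case
    -- applies.
    have inj : Function.Injective fun w => act w (treeHom x (of i)) :=
      (treeHom x (of i)).1.unop.injective
    apply inj
    have h : ∀ (g : treeAut) (w : List Bool), act (act w g⁻¹) g = w := fun g w => by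
      rw [← act_mul, inv_mul_cancel, act_one]
    simp only [map_inv, h, ih]
    simp [h]
  | mul g h ihg ihh => simp [act_mul, ihg, ihh]

theorem recursion_mem_base_ker {g : FreeGroup (Fin (m + 1))} (hg : g ∈ (treeHom x).ker) :
    recursion x g ∈ Wreath.base (treeHom x).ker := by
  rw [MonoidHom.mem_ker] at hg
  have h (s : Bool) (w : List Bool) := act_cons_treeHom x g s w
  simp only [hg, act_one, List.cons.injEq] at h
  refine ⟨by simpa using (h false []).1.symm, fun s => ?_⟩
  rw [MonoidHom.mem_ker]
  exact act_ext fun w => (h s w).2.symm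

theorem relatorSubgroup_le_ker_treeHom : relatorSubgroup x ≤ (treeHom x).ker := by
  intro g hg
  refine act_ext fun w => ?_
  induction w generalizing g with
  | nil => rw [act_nil, act_nil]
  | cons s w ih =>
    obtain ⟨h, h'⟩ := relatorSubgroup_le_comap_recursion x hg
    rw [act_cons_treeHom, h, ih (h' s)]
    simp [act_one]

/-! ### Commutation relations in the presented group. -/

/-- The presented group, as a quotient of the free group. -/
abbrev Presented : Type := FreeGroup (Fin (m + 1)) ⧸ relatorSubgroup x

/-- The projection from the free group to the presented group. -/
abbrev proj : FreeGroup (Fin (m + 1)) →* Presented x := QuotientGroup.mk' (relatorSubgroup x)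

theorem proj_eq_one {g : FreeGroup (Fin (m + 1))} : proj x g = 1 ↔ g ∈ relatorSubgroup x :=
  QuotientGroup.eq_one_iff g

/-- The image of `a_{i+1}` in the presented group. -/
abbrev letter (i : Fin (m + 1)) : Presented x := proj x (of i)

/-- The endomorphism of the presented group induced by `φ`. -/
def phiBar : Presented x →* Presented x :=
  QuotientGroup.map _ _ (phi x) (relatorSubgroup_le_comap_phi x)

theorem phiBar_proj (g : FreeGroup (Fin (m + 1))) : phiBar x (proj x g) = proj x (phi x g) := rfl

/-- The endomorphism `φ` followed by conjugation by `a₁`. -/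
def phiBarConj : Presented x →* Presented x :=
  (MulAut.conj (letter x 0)⁻¹).toMonoidHom.comp (phiBar x)

theorem phiBarConj_apply (g : Presented x) :
    phiBarConj x g = (letter x 0)⁻¹ * phiBar x g * letter x 0 := by
  simp [phiBarConj]

/-- The image of `φ(a_i)`, `i < n`; its wreath recursion is `⟨a_i, 1⟩`. -/
def leftGen (j : Fin m) : Presented x := phiBar x (letter x j.castSucc)

/-- The image of `φ(a_i) ^ a₁`, `i < n`; its wreath recursion is `⟨1, a_i⟩`. -/
def rightGen (j : Fin m) : Presented x := phiBarConj x (letter x j.castSucc)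

theorem phiBar_last : phiBar x (letter x (Fin.last m)) = letter x 0 ^ 2 := by
  rw [phiBar_proj, phi_last, map_pow]

theorem phiBarConj_last : phiBarConj x (letter x (Fin.last m)) = letter x 0 ^ 2 := by
  rw [phiBarConj_apply, phiBar_last]
  group

/-- The generators `φ(a_i)` are conjugates of `a_{i+1}` by these powers of `a₁`. -/
def twist (j : Fin m) : ℤ := if x j = false then 0 else 1

theorem leftGen_eq (j : Fin m) : leftGen x j =
    letter x 0 ^ twist x j * letter x j.succ * (letter x 0 ^ twist x j)⁻¹ := by
  rw [leftGen, phiBar_proj, phi_castSucc, twist]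
  split_ifs <;> simp

theorem rightGen_eq_conj (j : Fin m) :
    rightGen x j = (letter x 0)⁻¹ * leftGen x j * letter x 0 := phiBarConj_apply _ _

theorem rightGen_eq (j : Fin m) : rightGen x j =
    letter x 0 ^ (twist x j - 1) * letter x j.succ * (letter x 0 ^ (twist x j - 1))⁻¹ := by
  rw [rightGen_eq_conj, leftGen_eq]
  group

theorem conj_rightGen_eq (j : Fin m) : letter x 0 ^ 2 * rightGen x j * (letter x 0 ^ 2)⁻¹ =
    letter x 0 ^ (twist x j + 1) * letter x j.succ * (letter x 0 ^ (twist x j + 1))⁻¹ := by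
  rw [rightGen_eq_conj, leftGen_eq]
  group

theorem commute_letter_conj {p q : Fin m} {k : ℕ} (hk : k ≤ 2)
    (h : Even k ∧ x p ≠ x q ∨ Odd k ∧ x p = x q) :
    Commute (letter x p.succ) (conj (letter x q.succ) (letter x 0 ^ k)) := by
  rw [← comm_eq_one_iff, ← map_pow, ← map_conj, ← map_comm, proj_eq_one]
  exact Subgroup.subset_normalClosure (Set.mem_iUnion.2 ⟨0, _, ⟨p, q, k, hk, h, rfl⟩, rfl⟩)

theorem commute_conj_letter_of_le {p q : Fin m} {i j : ℤ} (hji : j ≤ i) (hij : i ≤ j + 2)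
    (h : Even (i - j) ∧ x p ≠ x q ∨ Odd (i - j) ∧ x p = x q) :
    Commute (letter x 0 ^ i * letter x p.succ * (letter x 0 ^ i)⁻¹)
      (letter x 0 ^ j * letter x q.succ * (letter x 0 ^ j)⁻¹) := by
  obtain ⟨k, hk⟩ := Int.le.dest hji
  obtain rfl : j = i - k := by omega
  rw [sub_sub_cancel, Int.even_coe_nat, Int.odd_coe_nat] at h
  have h' := (Commute.conj_iff (letter x 0 ^ i)).2
    (commute_letter_conj x (p := p) (q := q) (k := k) (by omega) h)
  convert h' using 1
  rw [conj]
  group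

theorem commute_conj_letter {p q : Fin m} {i j : ℤ} (hji : j ≤ i + 2) (hij : i ≤ j + 2)
    (h : Even (i - j) ∧ x p ≠ x q ∨ Odd (i - j) ∧ x p = x q) :
    Commute (letter x 0 ^ i * letter x p.succ * (letter x 0 ^ i)⁻¹)
      (letter x 0 ^ j * letter x q.succ * (letter x 0 ^ j)⁻¹) := by
  rcases le_total j i with hle | hle
  · exact commute_conj_letter_of_le x hle hij h
  · refine (commute_conj_letter_of_le x hle hji ?_).symm
    rwa [← neg_sub, even_neg, odd_neg, ne_comm, eq_comm (a := x q)]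

/-- The exponents of a₁ differ by `twist x i - twist x j + 1`, which is 1 if `x i = x j` and 0 or 2
otherwise: this is the range and parity of `k` in R₂. For the a₁²-conjugate below, the difference is
smaller by 2. -/
theorem commute_leftGen_rightGen (i j : Fin m) : Commute (leftGen x i) (rightGen x j) := by
  rw [leftGen_eq, rightGen_eq]
  refine commute_conj_letter x ?_ ?_ ?_ <;> unfold twist <;> cases x i <;> cases x j <;> decide

theorem commute_leftGen_conj_rightGen (i j : Fin m) :
    Commute (leftGen x i) (letter x 0 ^ 2 * rightGen x j * (letter x 0 ^ 2)⁻¹) := by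
  rw [leftGen_eq, conj_rightGen_eq]
  refine commute_conj_letter x ?_ ?_ ?_ <;> unfold twist <;> cases x i <;> cases x j <;> decide

/-- In the presented group, `φ(a_i)` commutes with all conjugates of `φ(a_j) ^ a₁` by powers of
`a₁²`. -/
theorem commute_leftGen_conj_zpow_rightGen (i j : Fin m) (k : ℤ) : Commute (leftGen x i)
    ((letter x 0 ^ 2) ^ k * rightGen x j * ((letter x 0 ^ 2) ^ k)⁻¹) := by
  -- `f` marks a₁ and `l` marks a_n; both exist because `Fin m` is inhabited by `j`.
  obtain ⟨f, hf⟩ : ∃ f : Fin m, f.castSucc = 0 := ⟨⟨0, by have := j.2; omega⟩, rfl⟩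
  obtain ⟨l, hl⟩ : ∃ l : Fin m, l.succ = Fin.last m :=
    ⟨⟨m - 1, by have := j.2; omega⟩, by ext; have := j.2; simp; omega⟩
  have he : rightGen x f = phiBarConj x (letter x 0) := by rw [rightGen, hf]
  -- Under `phiBarConj`, a_n becomes a₁² and a₁ becomes `rightGen x f`, so relations between a_n and
  -- conjugates of a_q become relations for a₁².
  have key {q : Fin m} {k : ℕ} (hk : k ≤ 2) (h : Even k ∧ x l ≠ x q ∨ Odd k ∧ x l = x q) :
      Commute (letter x 0 ^ 2)
        (conj (phiBarConj x (letter x q.succ)) (rightGen x f ^ k)) := by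
    have := (commute_letter_conj x hk h).map (phiBarConj x)
    rwa [map_conj, map_pow, hl, phiBarConj_last, ← he] at this
  have first (k : ℤ) : Commute (leftGen x i)
      ((letter x 0 ^ 2) ^ k * rightGen x f * ((letter x 0 ^ 2) ^ k)⁻¹) := by
    refine commute_conj_zpow ?_ (commute_leftGen_rightGen x i f)
      (commute_leftGen_conj_rightGen x i f) k
    have := key (q := l) (k := 1) (by norm_num) (by simp)
    rwa [hl, phiBarConj_last, pow_one, conj] at this
  rcases Fin.eq_zero_or_eq_succ j.castSucc with hj | ⟨q, hq⟩
  · obtain rfl : j = f := Fin.castSucc_injective _ (hj.trans hf.symm)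
    exact first k
  -- In the equal case the relation with `k = 1` reduces `j` to `f`; otherwise `k = 0` shows that
  -- a₁² already commutes with `rightGen x j`.
  · by_cases h : x l = x q
    · refine commute_conj_zpow_of_commute_conj (first k) (commute_leftGen_rightGen x i f)
        (commute_leftGen_rightGen x i j) ?_
      have := key (q := q) (k := 1) (by norm_num) (by simp [h])
      rwa [← hq, pow_one, conj] at this
    · have := key (q := q) (k := 0) (by norm_num) (by simp [h])
      rw [← hq, pow_zero, conj, inv_one, one_mul, mul_one] at this
      change Commute _ (rightGen x j) at this
      rw [(this.zpow_left k).eq, mul_inv_cancel_right]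
      exact commute_leftGen_rightGen x i j

/-! ### The first-level stabilizer and injectivity of the recursion. -/

/-- The image of `φ` in the presented group. -/
def leftSubgroup : Subgroup (Presented x) := ((proj x).comp (phi x)).range

/-- The subgroup generated by the conjugates of the elements `φ(a_i) ^ a₁`, `i < n`, by powers of
`a₁²`. -/
def rightSubgroup : Subgroup (Presented x) :=
  Subgroup.closure (Set.range fun jk : Fin m × ℤ =>
    (letter x 0 ^ 2) ^ jk.2 * rightGen x jk.1 * ((letter x 0 ^ 2) ^ jk.2)⁻¹)

theorem conj_mem_rightSubgroup {h : Presented x} (hh : h ∈ rightSubgroup x) (k : ℤ) :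
    (letter x 0 ^ 2) ^ k * h * ((letter x 0 ^ 2) ^ k)⁻¹ ∈ rightSubgroup x := by
  suffices h : rightSubgroup x ≤
      (rightSubgroup x).comap (MulAut.conj ((letter x 0 ^ 2) ^ k)).toMonoidHom from h hh
  refine (Subgroup.closure_le _).2 ?_
  rintro _ ⟨⟨j, l⟩, rfl⟩
  refine Subgroup.subset_closure ⟨⟨j, k + l⟩, ?_⟩
  change _ = (letter x 0 ^ 2) ^ k * ((letter x 0 ^ 2) ^ l * rightGen x j *
    ((letter x 0 ^ 2) ^ l)⁻¹) * ((letter x 0 ^ 2) ^ k)⁻¹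
  simp only [zpow_add, mul_assoc, mul_inv_rev]

theorem leftSubgroup_le_normalizer :
    leftSubgroup x ≤ Subgroup.normalizer (rightSubgroup x : Set (Presented x)) := by
  rintro _ ⟨g, rfl⟩
  induction g using FreeGroup.induction_on with
  | C1 => simp only [map_one, one_mem]
  | of i =>
    rw [Subgroup.mem_normalizer_iff]
    intro h
    induction i using Fin.lastCases with
    | last =>
      -- φ(a_n) = a₁² permutes the generators of `rightSubgroup x`, while the other φ(a_i)
      -- centralize them.
      simp only [MonoidHom.comp_apply, phi_last, map_pow]
      refine ⟨fun hh => by simpa using conj_mem_rightSubgroup x hh 1, fun hh => ?_⟩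
      simpa [mul_assoc] using conj_mem_rightSubgroup x hh (-1)
    | cast i =>
      have comm {h} (hh : h ∈ rightSubgroup x) : Commute (leftGen x i) h := by
        suffices h : rightSubgroup x ≤ Subgroup.centralizer {leftGen x i} from
          (Subgroup.mem_centralizer_singleton_iff.1 (h hh)).symm
        refine (Subgroup.closure_le _).2 ?_
        rintro _ ⟨⟨j, l⟩, rfl⟩
        exact Subgroup.mem_centralizer_singleton_iff.2
          (commute_leftGen_conj_zpow_rightGen x i j l).symm
      change _ ↔ leftGen x i * h * (leftGen x i)⁻¹ ∈ _
      refine ⟨fun hh => by rwa [(comm hh).eq, mul_inv_cancel_right], fun hh => ?_⟩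
      have := comm hh
      rw [commute_iff_eq, inv_mul_cancel_right, mul_assoc, mul_right_inj] at this
      rwa [mul_assoc, this] at hh
  | inv_of i ih => simpa only [map_inv] using inv_mem ih
  | mul g h ihg ihh => simpa only [map_mul] using mul_mem ihg ihh

/-- Since a₁² is the image of a_n under `phiBarConj`, each generator lifts to a conjugate of a_j by
a power of a_n, where the exponents of a_n cancel. -/
theorem rightSubgroup_le :
    rightSubgroup x ≤ (lastExponent m).ker.map ((phiBarConj x).comp (proj x)) := by
  refine (Subgroup.closure_le _).2 ?_
  rintro _ ⟨⟨j, k⟩, rfl⟩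
  refine ⟨of (Fin.last m) ^ k * of j.castSucc * (of (Fin.last m) ^ k)⁻¹, ?_, ?_⟩
  · simp [MonoidHom.mem_ker]
  · simp only [MonoidHom.comp_apply, map_mul, map_inv, map_zpow, phiBarConj_last]
    rfl

theorem sq_mem : letter x 0 ^ 2 ∈ leftSubgroup x ⊔ rightSubgroup x :=
  Subgroup.mem_sup_left ⟨of (Fin.last m), by simp⟩

/-- With t = `twist x j`, the available conjugates of the letter have a₁-exponents t, t - 1 and t +
1. For t = 0 or 1 these include both 0 and 1. -/
theorem letter_succ_mem (j : Fin m) :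
    letter x j.succ ∈ leftSubgroup x ⊔ rightSubgroup x ∧
      letter x 0 * letter x j.succ * (letter x 0)⁻¹ ∈ leftSubgroup x ⊔ rightSubgroup x := by
  have hl : leftGen x j ∈ leftSubgroup x ⊔ rightSubgroup x :=
    Subgroup.mem_sup_left ⟨of j.castSucc, rfl⟩
  have hr : rightGen x j ∈ leftSubgroup x ⊔ rightSubgroup x :=
    Subgroup.mem_sup_right (Subgroup.subset_closure ⟨⟨j, 0⟩, by simp⟩)
  have hr' : letter x 0 ^ 2 * rightGen x j * (letter x 0 ^ 2)⁻¹ ∈ leftSubgroup x ⊔ rightSubgroup x :=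
    mul_mem (mul_mem (sq_mem x) hr) (inv_mem (sq_mem x))
  rw [conj_rightGen_eq] at hr'
  rw [leftGen_eq] at hl
  rw [rightGen_eq] at hr
  unfold twist at hl hr hr'
  cases h : x j
  · simp only [h, if_true, zpow_zero, one_mul, inv_one, mul_one, zero_add, zpow_one] at hl hr'
    exact ⟨hl, hr'⟩
  · simp only [h, Bool.true_eq_false, if_false, sub_self, zpow_zero, one_mul, inv_one, mul_one,
      zpow_one] at hl hr
    exact ⟨hr, hl⟩

/-- The preimage in the free group of the product of both subgroups contains the elements that
fix the first level of the tree. -/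
theorem proj_mem (g : FreeGroup (Fin (m + 1))) :
    proj x g * (letter x 0)⁻¹ ^ (recursion x g).flip.toNat ∈
      leftSubgroup x ⊔ rightSubgroup x := by
  have hg : g ∈ Subgroup.closure (Set.range (of : Fin (m + 1) → _)) := by
    simp [FreeGroup.closure_range_of]
  induction hg using Subgroup.closure_induction_right with
  | one => simp
  -- Schreier's argument for the transversal {1, a₁}: the generators to absorb are a₁², a_j and a₁
  -- a_j a₁⁻¹.
  | mul_right g _ _ hy ih =>
    obtain ⟨i, rfl⟩ := hy
    induction i using Fin.cases with
    | zero =>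
      cases h : (recursion x g).flip
      · simpa [h] using ih
      · simpa [h, pow_two, mul_assoc] using mul_mem ih (sq_mem x)
    | succ j =>
      cases h : (recursion x g).flip
      · simpa [h] using mul_mem ih (letter_succ_mem x j).1
      · simpa [h, mul_assoc] using mul_mem ih (letter_succ_mem x j).2
  | mul_inv_cancel g _ _ hy ih =>
    obtain ⟨i, rfl⟩ := hy
    induction i using Fin.cases with
    | zero =>
      cases h : (recursion x g).flip
      · simpa [h, pow_two, mul_assoc] using mul_mem ih (inv_mem (sq_mem x))
      · simpa [h] using ih
    | succ j =>
      cases h : (recursion x g).flip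
      · simpa [h] using mul_mem ih (inv_mem (letter_succ_mem x j).1)
      · simpa [h, mul_assoc] using mul_mem ih (inv_mem (letter_succ_mem x j).2)

/-- The wreath recursion of the presented group is injective. -/
theorem mem_relatorSubgroup_of_recursion_mem {g : FreeGroup (Fin (m + 1))}
    (hg : recursion x g ∈ Wreath.base (relatorSubgroup x)) : g ∈ relatorSubgroup x := by
  have hmem := proj_mem x g
  rw [hg.1, Bool.toNat_false, pow_zero, mul_one, ← SetLike.mem_coe,
    Subgroup.coe_mul_of_left_le_normalizer_right _ _ (leftSubgroup_le_normalizer x)] at hmem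
  obtain ⟨_, ⟨u, rfl⟩, y, hy, h⟩ := hmem
  obtain ⟨w, hw, rfl⟩ := rightSubgroup_le x hy
  have hw : lastExponent m w = 1 := hw
  have h' : proj x (phi x u * ((of 0)⁻¹ * phi x w * of 0)) = proj x g := by
    rw [← h]
    simp only [map_mul, map_inv, MonoidHom.comp_apply, phiBarConj_apply, phiBar_proj]
  have hmem : recursion x (phi x u * ((of 0)⁻¹ * phi x w * of 0)) ∈
      Wreath.base (relatorSubgroup x) := by
    have h₁ := relatorSubgroup_le_comap_recursion x (QuotientGroup.eq.1 h'.symm)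
    rw [Subgroup.mem_comap, map_mul, map_inv] at h₁
    exact (Subgroup.mul_mem_cancel_left _ (inv_mem hg)).1 h₁
  have hu : u ∈ relatorSubgroup x := by
    simpa [recursion_phi, hw] using hmem.2 false
  have hu' : lastExponent m u = 1 := relatorSubgroup_le_ker_lastExponent x hu
  have hw' : w ∈ relatorSubgroup x := by
    simpa [recursion_phi, hu'] using hmem.2 true
  rw [← proj_eq_one, ← h']
  have hu₁ := (proj_eq_one x).2 (relatorSubgroup_le_comap_phi x hu)
  have hw₁ := (proj_eq_one x).2 (relatorSubgroup_le_comap_phi x hw')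
  simp only [map_mul, map_inv, hu₁, hw₁]
  group

/-! ### Sections of words and their lengths. -/

/-- Signed letters `a_i ^ {±1}`. -/
abbrev Letter (m : ℕ) : Type := Fin (m + 1) × Bool

/-- Whether a signed letter, read at the first-level vertex `s`, has a nontrivial section. -/
def emits (s : Bool) (a : Letter m) : Bool := Fin.cases (s == a.2) (fun j => s == x j) a.1

/-- The first-level vertex to which a signed letter moves `s`. -/
def turn (s : Bool) (a : Letter m) : Bool := if a.1 = 0 then !s else s

/-- The cyclic shift of the indices of the letters. -/
def shiftIndex (i : Fin (m + 1)) : Fin (m + 1) := Fin.cases (Fin.last m) Fin.castSucc i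

/-- The nontrivial section of a signed letter. -/
def shift (a : Letter m) : Letter m := (shiftIndex a.1, a.2)

theorem shiftIndex_injective : Function.Injective (shiftIndex (m := m)) := by
  intro i j h
  induction i using Fin.cases <;> induction j using Fin.cases <;>
    simp_all [shiftIndex, Fin.ext_iff] <;> omega

/-- The section of a word at the first-level vertex `s`, as a word. -/
def sections : Bool → List (Letter m) → List (Letter m)
  | _, [] => []
  | s, a :: L => if emits x s a then shift a :: sections (turn s a) L else sections (turn s a) L

/-- All letters of the word contribute to its section at `s`. -/
def Full : Bool → List (Letter m) → Prop
  | _, [] => True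
  | s, a :: L => emits x s a = true ∧ Full (turn s a) L

theorem recursion_letter (a : Letter m) : recursion x (FreeGroup.mk [a]) =
    ⟨fun s => if emits x s a then FreeGroup.mk [shift a] else 1, decide (a.1 = 0)⟩ := by
  obtain ⟨i, _ | _⟩ := a
  · change recursion x (of i)⁻¹ = _
    rw [map_inv]
    induction i using Fin.cases with
    | zero => ext <;> simp [emits]; rfl
    | succ j =>
      cases h : x j <;> ext <;> simp [emits, h] <;> rfl
  · change recursion x (of i) = _
    induction i using Fin.cases with
    | zero => ext <;> simp [emits]; rfl
    | succ j =>
      cases h : x j <;> ext <;> simp [emits, h] <;> rfl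

theorem mk_cons (a : Letter m) (L : List (Letter m)) :
    FreeGroup.mk (a :: L) = FreeGroup.mk [a] * FreeGroup.mk L := rfl

theorem recursion_mk_sec (s : Bool) (L : List (Letter m)) :
    (recursion x (FreeGroup.mk L)).sec s = FreeGroup.mk (sections x s L) := by
  induction L generalizing s with
  | nil => rfl
  | cons a L ih =>
    have : (s ^^ decide (a.1 = 0)) = turn s a := by
      unfold turn
      split_ifs with h <;> simp [h]
    rw [mk_cons, map_mul, recursion_letter, Wreath.mul_sec, this, ih, sections]
    split_ifs with h
    · simp only [h, if_true]
      rfl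
    · simp [h]

theorem recursion_mk_flip (s : Bool) (L : List (Letter m)) :
    (s ^^ (recursion x (FreeGroup.mk L)).flip) = L.foldl turn s := by
  induction L generalizing s with
  | nil => exact Bool.xor_false s
  | cons a L ih =>
    have : (s ^^ decide (a.1 = 0)) = turn s a := by
      unfold turn
      split_ifs with h <;> simp [h]
    rw [mk_cons, map_mul, recursion_letter, Wreath.mul_flip, ← Bool.xor_assoc, this, ih]
    rfl

theorem turn_not (s : Bool) (a : Letter m) : turn (!s) a = !turn s a := by
  unfold turn
  split_ifs <;> rfl

theorem emits_not (s : Bool) (a : Letter m) : emits x (!s) a = !emits x s a := by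
  obtain ⟨i, e⟩ := a
  have h (s t : Bool) : ((!s) == t) = !(s == t) := by revert s t; decide
  induction i using Fin.cases <;> exact h _ _

/-- Each letter has its nontrivial section at exactly one of the two vertices, and the two readings
always stay at opposite vertices. -/
theorem length_sections_add (s : Bool) (L : List (Letter m)) :
    (sections x s L).length + (sections x (!s) L).length = L.length := by
  induction L generalizing s with
  | nil => rfl
  | cons a L ih =>
    have := ih (turn s a)
    cases h : emits x s a <;> simp [sections, emits_not, turn_not, h] <;> omega

theorem full_of_sections_eq_nil {s : Bool} {L : List (Letter m)} (h : sections x (!s) L = []) :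
    Full x s L := by
  induction L generalizing s with
  | nil => trivial
  | cons a L ih =>
    cases he : emits x s a
    · simp [sections, emits_not, he] at h
    · simp only [sections, emits_not, he, turn_not] at h
      exact ⟨he, ih h⟩

theorem sections_eq_map {s : Bool} {L : List (Letter m)} (h : Full x s L) :
    sections x s L = L.map shift := by
  induction L generalizing s with
  | nil => rfl
  | cons a L ih =>
    rw [sections, if_pos h.1, ih h.2, List.map_cons]

theorem full_append {s : Bool} {L L' : List (Letter m)} :
    Full x s (L ++ L') ↔ Full x s L ∧ Full x (L.foldl turn s) L' := by
  induction L generalizing s with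
  | nil => simp [Full]
  | cons a L ih => simp [Full, ih, and_assoc]

theorem foldl_turn_of_zero_notMem {L : List (Letter m)} (h : 0 ∉ L.map Prod.fst) (s : Bool) :
    L.foldl turn s = s := by
  induction L with
  | nil => rfl
  | cons a L ih =>
    simp only [List.map_cons, List.mem_cons, not_or] at h
    rw [List.foldl_cons, turn, if_neg (Ne.symm h.1)]
    exact ih h.2

/-! ### Patterns in reduced words. -/

/-- The index `j` occurs exactly once between two letters with equal index, different from `j`. -/
def Separates (j : Fin (m + 1)) (L : List (Letter m)) : Prop :=
  ∃ A a z w a' B, L = A ++ a :: z :: (w ++ a' :: B) ∧ a.1 = a'.1 ∧ z.1 = j ∧ a.1 ≠ j ∧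
    j ∉ w.map Prod.fst

/-- A letter with index `j` is followed by the same letter. -/
def Repeats (j : Fin (m + 1)) (L : List (Letter m)) : Prop :=
  ∃ A a B, L = A ++ a :: a :: B ∧ a.1 = j

/-- The index `j` occurs in the word exactly once, at its beginning. -/
def StartsOnce (j : Fin (m + 1)) (L : List (Letter m)) : Prop :=
  ∃ a B, L = a :: B ∧ a.1 = j ∧ j ∉ B.map Prod.fst

theorem shiftIndex_notMem {j : Fin (m + 1)} {L : List (Letter m)} (h : j ∉ L.map Prod.fst) :
    shiftIndex j ∉ (L.map shift).map Prod.fst := by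
  rw [List.map_map, show Prod.fst ∘ shift = shiftIndex ∘ (Prod.fst : Letter m → _) from rfl,
    ← List.map_map, List.mem_map_of_injective shiftIndex_injective]
  exact h

theorem Separates.map_shift {j : Fin (m + 1)} {L : List (Letter m)} (h : Separates j L) :
    Separates (shiftIndex j) (L.map shift) := by
  obtain ⟨A, a, z, w, a', B, rfl, h₁, rfl, h₂, h₃⟩ := h
  exact ⟨A.map shift, shift a, shift z, w.map shift, shift a', B.map shift, by simp,
    congrArg shiftIndex h₁, rfl, shiftIndex_injective.ne h₂, shiftIndex_notMem h₃⟩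

theorem Repeats.map_shift {j : Fin (m + 1)} {L : List (Letter m)} (h : Repeats j L) :
    Repeats (shiftIndex j) (L.map shift) := by
  obtain ⟨A, a, B, rfl, rfl⟩ := h
  exact ⟨A.map shift, shift a, B.map shift, by simp, rfl⟩

theorem StartsOnce.map_shift {j : Fin (m + 1)} {L : List (Letter m)} (h : StartsOnce j L) :
    StartsOnce (shiftIndex j) (L.map shift) := by
  obtain ⟨a, B, rfl, rfl, h⟩ := h
  exact ⟨shift a, B.map shift, rfl, rfl, shiftIndex_notMem h⟩

/-- A single a₁^{±1} in between makes the two equal indices be read at opposite vertices, but a_i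
with i > 1 has a nontrivial section only at x_{i-1}. -/
theorem not_full_of_separates {L : List (Letter m)} (h : Separates 0 L) (s : Bool) :
    ¬ Full x s L := by
  obtain ⟨A, a, z, w, a', B, rfl, h₁, h₂, h₃, h₄⟩ := h
  intro hF
  obtain ⟨ha, -, hF⟩ := ((full_append x).1 hF).2
  obtain ⟨ha', -⟩ := ((full_append x).1 hF).2
  rw [foldl_turn_of_zero_notMem h₄, turn, if_pos h₂, turn, if_neg h₃, emits_not] at ha'
  obtain ⟨i, e⟩ := a
  obtain ⟨i', e'⟩ := a'
  obtain rfl : i = i' := h₁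
  obtain ⟨j, rfl⟩ := Fin.exists_succ_eq.2 h₃
  simp_all [emits]

/-- The first letter flips the vertex, and the same letter cannot have a nontrivial section at both.
-/
theorem not_full_of_repeats {L : List (Letter m)} (h : Repeats 0 L) (s : Bool) :
    ¬ Full x s L := by
  obtain ⟨A, a, B, rfl, h⟩ := h
  intro hF
  obtain ⟨ha, ha', -⟩ := ((full_append x).1 hF).2
  rw [turn, if_pos h, emits_not, ha] at ha'
  exact absurd ha' (by decide)

/-- A nonempty reduced word contains one of the above patterns. -/
theorem exists_pattern {L : List (Letter m)} (hL : L ≠ [])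
    (hred : ∀ A a e B, L ≠ A ++ (a, e) :: (a, !e) :: B) :
    ∃ j, Separates j L ∨ Repeats j L ∨ StartsOnce j L := by
  by_cases hn : (L.map Prod.fst).Nodup
  · obtain ⟨a, B, rfl⟩ := List.exists_cons_of_ne_nil hL
    rw [List.map_cons, List.nodup_cons] at hn
    exact ⟨a.1, .inr (.inr ⟨a, B, rfl, rfl, hn.1⟩)⟩
  -- An innermost pair of equal indices, with pairwise distinct indices in between.
  have key : ∀ L : List (Letter m), ¬ (L.map Prod.fst).Nodup → ∃ A a w a' B,
      L = A ++ a :: (w ++ a' :: B) ∧ a.1 = a'.1 ∧ (w.map Prod.fst).Nodup ∧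
        a.1 ∉ w.map Prod.fst := by
    intro L
    induction L with
    | nil => simp
    | cons a L ih =>
      intro h
      by_cases hn : (L.map Prod.fst).Nodup
      · rw [List.map_cons, List.nodup_cons, and_iff_left hn, not_not] at h
        obtain ⟨a', ha', haa'⟩ := List.mem_map.1 h
        obtain ⟨w, B, rfl⟩ := List.append_of_mem ha'
        rw [List.map_append, List.map_cons, List.nodup_append'] at hn
        refine ⟨[], a, w, a', B, rfl, haa'.symm, hn.1, fun ha => ?_⟩
        exact hn.2.2 ha (by simp [haa'])
      · obtain ⟨A, b, w, b', B, rfl, h'⟩ := ih hn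
        exact ⟨a :: A, b, w, b', B, rfl, h'⟩
  obtain ⟨A, a, w, a', B, rfl, h₁, h₂, h₃⟩ := key L hn
  cases w with
  | nil =>
    -- The two letters are adjacent, so reducedness forces equal signs.
    refine ⟨a.1, .inr (.inl ⟨A, a, B, ?_, rfl⟩)⟩
    obtain ⟨i, e⟩ := a
    obtain ⟨i', e'⟩ := a'
    obtain rfl : i = i' := h₁
    have := hred A i e B
    cases e <;> cases e' <;> simp_all
  | cons z w =>
    rw [List.map_cons, List.nodup_cons] at h₂
    rw [List.map_cons, List.mem_cons, not_or] at h₃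
    exact ⟨z.1, .inl ⟨A, a, z, w, a', B, rfl, h₁, rfl, h₃.1, h₂.1⟩⟩

/-! ### Minimal counterexamples and the kernel. -/

/-- The kernel of the action is the normal closure of the relators. -/
theorem ker_treeHom_le : (treeHom x).ker ≤ relatorSubgroup x := by
  suffices h : ∀ n, ∀ L : List (Letter m), L.length = n → FreeGroup.mk L ∈ (treeHom x).ker →
      FreeGroup.mk L ∈ relatorSubgroup x by
    intro g hg
    rw [← FreeGroup.mk_toWord (x := g)] at hg ⊢
    exact h _ _ rfl hg
  intro n
  induction n using Nat.strong_induction_on with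
  | _ n ih =>
  by_contra! hbad
  let S : Set (List (Letter m)) := {L | L.length = n ∧ FreeGroup.mk L ∈ (treeHom x).ker ∧
    FreeGroup.mk L ∉ relatorSubgroup x}
  -- By injectivity some section lies outside N. By minimality it has full length, so the other
  -- section is empty.
  have step {L} (hL : L ∈ S) : L.map shift ∈ S ∧ ∃ s, Full x s L := by
    obtain ⟨hn, hK, hN⟩ := hL
    have hb := recursion_mem_base_ker x hK
    have hs : ∃ s, FreeGroup.mk (sections x s L) ∉ relatorSubgroup x := by
      by_contra! hs
      exact hN (mem_relatorSubgroup_of_recursion_mem x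
        ⟨hb.1, fun s => by rw [recursion_mk_sec]; exact hs s⟩)
    obtain ⟨s, hs⟩ := hs
    have hK' : FreeGroup.mk (sections x s L) ∈ (treeHom x).ker := by
      rw [← recursion_mk_sec]
      exact hb.2 s
    have hlen := length_sections_add x s L
    have hge : n ≤ (sections x s L).length := by
      by_contra! hlt
      exact hs (ih _ hlt _ rfl hK')
    have hF : Full x s L :=
      full_of_sections_eq_nil x (List.eq_nil_of_length_eq_zero (by omega))
    rw [sections_eq_map x hF] at hs hK'
    exact ⟨⟨by simpa using hn, hK', hs⟩, s, hF⟩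
  -- Shifting keeps the word in `S` and lowers the index of the pattern by one, down to a₁. There
  -- the first two patterns contradict `Full`, and a single a₁^{±1} would move the first level.
  have none (j : Fin (m + 1)) : ∀ L ∈ S, ¬ (Separates j L ∨ Repeats j L ∨ StartsOnce j L) := by
    induction j using Fin.induction with
    | zero =>
      rintro L hL (h | h | h)
      · obtain ⟨-, s, hF⟩ := step hL
        exact not_full_of_separates x h s hF
      · obtain ⟨-, s, hF⟩ := step hL
        exact not_full_of_repeats x h s hF
      · obtain ⟨a, B, rfl, h₁, h₂⟩ := h
        have := recursion_mk_flip x false (a :: B)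
        rw [(recursion_mem_base_ker x hL.2.1).1, List.foldl_cons,
          foldl_turn_of_zero_notMem h₂, turn, if_pos h₁] at this
        exact absurd this (by decide)
    | succ j ihj =>
      intro L hL h
      exact ihj _ (step hL).1
        (h.imp Separates.map_shift (Or.imp Repeats.map_shift StartsOnce.map_shift))
  obtain ⟨L, hn, hK, hN⟩ := hbad
  -- Cancelling an inverse pair gives a shorter word for the same element, so minimality makes `L`
  -- reduced.
  obtain ⟨j, hj⟩ := exists_pattern (L := L) (by rintro rfl; exact hN (one_mem _)) (by
    rintro A a e B rfl
    have h : FreeGroup.mk (A ++ (a, e) :: (a, !e) :: B) = FreeGroup.mk (A ++ B) :=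
      Quot.sound FreeGroup.Red.Step.not
    rw [h] at hK hN
    refine hN (ih (A ++ B).length ?_ _ rfl hK)
    rw [← hn]
    simp)
  exact none j L ⟨hn, hK, hN⟩ hj

/-! ### The isomorphism with the kneading group. -/

theorem range_treeHom : (treeHom x).range = kneadingGroup x := by
  rw [kneadingGroup, treeHom, FreeGroup.range_lift_eq_closure]

theorem finite_rels (r : ℕ) : (rels x r).Finite := by
  refine (Set.finite_range fun t : Fin m × Fin m × Fin (r + 1) =>
    comm (of t.1.succ) (conj (of t.2.1.succ) (of 0 ^ (t.2.2 : ℕ)))).subset ?_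
  rintro _ ⟨p, q, k, hk, -, rfl⟩
  exact ⟨(p, q, ⟨k, Nat.lt_succ_of_le hk⟩), rfl⟩

/-- The presented group is isomorphic to the kneading group. -/
noncomputable def presentedEquiv : Presented x ≃* kneadingGroup x :=
  (QuotientGroup.quotientMulEquivOfEq
    (le_antisymm (relatorSubgroup_le_ker_treeHom x) (ker_treeHom_le x))).trans
    ((QuotientGroup.quotientKerEquivRange (treeHom x)).trans
      (MulEquiv.subgroupCongr (range_treeHom x)))

end Kneading

/-- For every word `v = x₁ … x_{n-1}` over `{0, 1}`, with `n = m + 1 ≥ 1`, the set `R₂` is finite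
and `𝔎(v) = ⟨a₁, …, a_n | φ^ℓ(R₂) for all ℓ ≥ 0⟩`, the generators of the presentation being the
given generators of `𝔎(v)`. -/
theorem mainTheorem2 (m : ℕ) (x : Fin m → Bool) :
    (Kneading.rels x 2).Finite ∧
    ∃ e : PresentedGroup (⋃ l : ℕ, (Kneading.phi x)^[l] '' Kneading.rels x 2) ≃*
        Kneading.kneadingGroup x,
      ∀ i : Fin (m + 1), (e (PresentedGroup.of i) : Kneading.treeAut) = Kneading.gen x i :=
  -- `PresentedGroup` unfolds to the quotient `Presented x`, and `presentedEquiv` sends the class of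
  -- a generator to its value under `treeHom`.
  ⟨Kneading.finite_rels x 2, Kneading.presentedEquiv x, fun i => Kneading.treeHom_of x i⟩
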